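/- Let $d$ be a non-negative integer or $d=\infty$ (countable infinity), let $\mathbb{C}^d$ be the $d$-dimensional complex Hilbert space ($\ell^2(\mathbb{N})$ if $d=\infty$), with inner product linear in the first variable, and let $\mathbb{B}_d$ be its open unit ball. The Drury–Arveson space $H^2_d$ is the Hilbert space of functions $f:\mathbb{B}_d\to\mathbb{C}$ given by power series $f(z)=\sum_\alpha c_\alpha z^\alpha$ (over finitely supported multi-indices $\alpha$) with $$\|f\|^2=\sum_\alpha |c_\alpha|^2\,\frac{\alpha!}{|\alpha|!}<\infty .$$ It is a Hilbert function space on $\mathbb{B}_d$ with reproducing kernel $k(z,w)=\dfrac{1}{1-\langle z,w\rangle}$. A function $\varphi:\mathbb{B}_d\to\mathbb{C}$ is a multiplier of $H^2_d$ if $\varphi h\in H^2_d$ for all $h\in H^2_d$. A contractive $M_m(\mathbb{C})$-valued multiplier is a function $\Phi=[\varphi_{ab}]_{a,b=1}^m:\mathbb{B}_d\to M_m(\mathbb{C})$ whose entries are multipliers of $H^2_d$ and for which the operator $M_\Phi:h\mapsto \Phi h$ on $H^2_d\otimes\mathbb{C}^m$ has norm at most $1$. **Theorem.** The Drury–Arveson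 space $H^2_d$ has the complete Pick property: for all $m,n\in\mathbb{N}$, all points $x_1,\dots,x_n\in\mathbb{B}_d$ (not necessarily distinct) and all matrices $W_1,\dots,W_n\in M_m(\mathbb{C})$, the following two conditions are equivalent: 1. there is a contractive $M_m(\mathbb{C})$-valued multiplier $\Phi$ of $H^2_d$ such that $\Phi(x_i)=W_i$ for all $i=1,\dots,n$; 2. the $mn\times mn$ block matrix whose $m\times m$ block in block row $j$ and block column $i$ is $(I-W_jW_i^*)\,k(x_j,x_i)$, $i,j=1,\dots,n$, is positive semi-definite. -/

import Mathlib

noncomputable section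

open scoped ComplexOrder

/-! ### Complete Pick spaces -/

section Pick

variable {X : Type*} (H : Type*) [NormedAddCommGroup H] [InnerProductSpace ℂ H] [RKHS ℂ H X ℂ]

/-- `φ` is a (scalar) multiplier of the Hilbert function space `H`: `φ h ∈ H` for all `h ∈ H`. -/
def IsMultiplier (φ : X → ℂ) : Prop :=
  ∀ h : H, ∃ g : H, ∀ x, g x = φ x * h x

/-- `Φ ∈ Mult(H) ⊗ M_m(ℂ)`, and the multiplication operator `h ↦ Φ h` on
`H ⊗ ℂᵐ` (the Hilbert direct sum of `m` copies of `H`) has norm at most one. -/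
def IsContractiveMultiplier {m : ℕ} (Φ : X → Matrix (Fin m) (Fin m) ℂ) : Prop :=
  (∀ a b, IsMultiplier H fun x => Φ x a b) ∧
    ∀ h g : PiLp 2 (fun _ : Fin m => H),
      (∀ x a, g a x = ∑ b, Φ x a b * h b x) → ‖g‖ ≤ ‖h‖

/-- The Pick matrix, of size `nm × nm`: its `m × m` block in block row `j` and block column `i` is
`K(x j, x i) (I - W j (W i)ᴴ)`, where `K` is the reproducing kernel of `H`. -/
def pickMatrix [CompleteSpace H] {m n : ℕ} (x : Fin n → X)
    (W : Fin n → Matrix (Fin m) (Fin m) ℂ) : Matrix (Fin n × Fin m) (Fin n × Fin m) ℂ :=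
  Matrix.of fun p q =>
    (1 - W p.1 * (W q.1).conjTranspose) p.2 q.2 * RKHS.kernel H (x p.1) (x q.1) 1

/-- The complete Pick property of a Hilbert function space. -/
def HasCompletePickProperty [CompleteSpace H] : Prop :=
  ∀ (m n : ℕ) (x : Fin n → X) (W : Fin n → Matrix (Fin m) (Fin m) ℂ),
    (∃ Φ : X → Matrix (Fin m) (Fin m) ℂ, IsContractiveMultiplier H Φ ∧ ∀ i, Φ (x i) = W i) ↔
      (pickMatrix H x W).PosSemidef

end Pick

/-! ### The Drury–Arveson space -/

/-- The open unit ball of the Hilbert space `ℓ²(ι)` (`ℂᵈ` when `ι` has `d` elements). -/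
abbrev DABall (ι : Type*) : Type _ :=
  ↥(Metric.ball (0 : lp (fun _ : ι => ℂ) 2) 1)

/-- The monomial `z ^ α`. -/
def daMonomial {ι : Type*} (α : ι →₀ ℕ) (z : ι → ℂ) : ℂ :=
  α.prod fun i k => z i ^ k

/-- The Drury–Arveson space `H²_d`, `d` being the cardinality of `ι`: power series
`f(z) = ∑ c_α z ^ α` with `‖f‖² = ∑ |c_α|² α! / |α|! < ∞`. An element is stored through its
coordinates `√(α! / |α|!) c_α` in the orthonormal basis of normalized monomials;
see `DruryArveson.coeff` and `DruryArveson.hasSum_norm_sq`. -/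
def DruryArveson (ι : Type*) : Type _ := lp (fun _ : ι →₀ ℕ => ℂ) 2

namespace DruryArveson

variable {ι : Type*}

instance : NormedAddCommGroup (DruryArveson ι) :=
  inferInstanceAs (NormedAddCommGroup (lp (fun _ : ι →₀ ℕ => ℂ) 2))

instance : InnerProductSpace ℂ (DruryArveson ι) :=
  inferInstanceAs (InnerProductSpace ℂ (lp (fun _ : ι →₀ ℕ => ℂ) 2))

instance : CompleteSpace (DruryArveson ι) :=
  inferInstanceAs (CompleteSpace (lp (fun _ : ι →₀ ℕ => ℂ) 2))

/-- The coordinates of `f` in the orthonormal basis of normalized monomials. -/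
def coord (f : DruryArveson ι) : (ι →₀ ℕ) → ℂ :=
  (show lp (fun _ : ι →₀ ℕ => ℂ) 2 from f : (ι →₀ ℕ) → ℂ)

/-- The Taylor coefficient `c_α` of `f`; here `α.multinomial = |α|! / α!`. -/
def coeff (f : DruryArveson ι) (α : ι →₀ ℕ) : ℂ :=
  (√(α.multinomial : ℝ) : ℂ) * coord f α

theorem multinomial_pos' (α : ι →₀ ℕ) : (0 : ℝ) < α.multinomial := by
  rw [Finsupp.multinomial_eq]
  exact_mod_cast Nat.multinomial_pos _ _

theorem hasSum_norm_sq (f : DruryArveson ι) :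
    HasSum (fun α => ‖coeff f α‖ ^ 2 * (α.multinomial : ℝ)⁻¹) (‖f‖ ^ 2) := by
  have h := lp.hasSum_norm (p := 2) (by norm_num)
    (show lp (fun _ : ι →₀ ℕ => ℂ) 2 from f)
  have h2 : HasSum (fun α => ‖coord f α‖ ^ 2) (‖f‖ ^ 2) := by
    simpa using! h
  convert h2 using 2 with α
  have := multinomial_pos' α
  rw [coeff, norm_mul, mul_pow, Complex.norm_real, Real.norm_eq_abs, sq_abs,
    Real.sq_sqrt this.le]
  field_simp

/-- The multinomial theorem. -/
theorem sum_finsuppAntidiag [DecidableEq ι] {R : Type*} [CommSemiring R] (S : Finset ι) (n : ℕ)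
    (u : ι → R) :
    ∑ α ∈ S.finsuppAntidiag n, (α.multinomial : R) * α.prod (fun i k => u i ^ k)
      = (∑ i ∈ S, u i) ^ n := by
  rw [Finset.sum_pow_eq_sum_piAntidiag]
  refine Finset.sum_bij (fun α _ => ⇑α) ?_ ?_ ?_ ?_
  · intro α hα
    rw [Finset.mem_finsuppAntidiag] at hα
    rw [Finset.mem_piAntidiag]
    exact ⟨hα.1, fun i hi => hα.2 (by simpa using hi)⟩
  · intro α _ β _ h
    exact DFunLike.coe_injective h
  · intro k hk
    rw [Finset.mem_piAntidiag] at hk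
    refine ⟨Finsupp.onFinset S k hk.2, ?_, rfl⟩
    rw [Finset.mem_finsuppAntidiag]
    exact ⟨hk.1, Finsupp.support_onFinset_subset⟩
  · intro α hα
    rw [Finset.mem_finsuppAntidiag] at hα
    rw [Finsupp.multinomial_eq_of_support_subset hα.2,
      Finsupp.prod_of_support_subset _ hα.2 _ (by simp)]

theorem sum_biUnion_finsuppAntidiag [DecidableEq ι] {R : Type*} [CommSemiring R]
    (S : Finset ι) (N : ℕ) (u : ι → R) :
    ∑ α ∈ (Finset.range N).biUnion (fun n => S.finsuppAntidiag n),
      (α.multinomial : R) * α.prod (fun i k => u i ^ k)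
      = ∑ n ∈ Finset.range N, (∑ i ∈ S, u i) ^ n := by
  rw [Finset.sum_biUnion]
  · exact Finset.sum_congr rfl fun n _ => sum_finsuppAntidiag S n u
  · intro a _ b _ hab
    refine Finset.disjoint_left.2 fun α h1 h2 => hab ?_
    rw [Finset.mem_finsuppAntidiag] at h1 h2
    exact h1.1.symm.trans h2.1

theorem subset_biUnion_finsuppAntidiag [DecidableEq ι] (F : Finset (ι →₀ ℕ)) :
    ∃ (S : Finset ι) (N : ℕ), ∀ S' N', S ≤ S' → N ≤ N' →
      F ⊆ (Finset.range N').biUnion (fun n => S'.finsuppAntidiag n) := by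
  refine ⟨F.biUnion Finsupp.support, (F.sup fun α => α.sum fun _ k => k) + 1, ?_⟩
  intro S' N' hS hN α hα
  rw [Finset.mem_biUnion]
  refine ⟨α.sum fun _ k => k, ?_, ?_⟩
  · rw [Finset.mem_range]
    have := Finset.le_sup (f := fun α : ι →₀ ℕ => α.sum fun _ k => k) hα
    exact lt_of_lt_of_le (Nat.lt_succ_of_le this) hN
  · rw [Finset.mem_finsuppAntidiag']
    exact ⟨rfl, (Finset.subset_biUnion_of_mem Finsupp.support hα).trans hS⟩

theorem summable_multinomial (x : ι → ℝ) (hx : ∀ i, 0 ≤ x i) (hs : Summable x)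
    (h1 : ∑' i, x i < 1) :
    Summable fun α : ι →₀ ℕ => (α.multinomial : ℝ) * α.prod (fun i k => x i ^ k) := by
  classical
  refine summable_of_sum_le (c := (1 - ∑' i, x i)⁻¹) ?_ ?_
  · intro α
    exact mul_nonneg (Nat.cast_nonneg _) (Finset.prod_nonneg fun i _ => pow_nonneg (hx i) _)
  · intro F
    obtain ⟨S, N, h⟩ := subset_biUnion_finsuppAntidiag F
    have hT : 0 ≤ ∑' i, x i := tsum_nonneg hx
    calc _ ≤ _ := Finset.sum_le_sum_of_subset_of_nonneg (h S N le_rfl le_rfl) (fun α _ _ =>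
            mul_nonneg (Nat.cast_nonneg _) (Finset.prod_nonneg fun i _ => pow_nonneg (hx i) _))
      _ = ∑ n ∈ Finset.range N, (∑ i ∈ S, x i) ^ n := sum_biUnion_finsuppAntidiag S N x
      _ ≤ ∑ n ∈ Finset.range N, (∑' i, x i) ^ n := by
          gcongr with n _
          · exact Finset.sum_nonneg fun i _ => hx i
          · exact hs.sum_le_tsum _ fun i _ => hx i
      _ ≤ ∑' n : ℕ, (∑' i, x i) ^ n :=
          (summable_geometric_of_lt_one hT h1).sum_le_tsum _ fun n _ => pow_nonneg hT n
      _ = _ := tsum_geometric_of_lt_one hT h1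

theorem hasSum_multinomial (u : ι → ℂ) (hs : Summable fun i => ‖u i‖) (h1 : ∑' i, ‖u i‖ < 1) :
    HasSum (fun α : ι →₀ ℕ => (α.multinomial : ℂ) * α.prod (fun i k => u i ^ k))
      (1 - ∑' i, u i)⁻¹ := by
  classical
  have hsum : Summable
      (fun α : ι →₀ ℕ => (α.multinomial : ℂ) * α.prod (fun i k => u i ^ k)) := by
    refine Summable.of_norm ?_
    convert summable_multinomial (fun i => ‖u i‖) (fun i => norm_nonneg _) hs h1 using 2 with α
    simp [Finsupp.prod, norm_prod]
  obtain ⟨a, ha⟩ := hsum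
  have ht : Filter.Tendsto (fun p : Finset ι × ℕ =>
      (Finset.range p.2).biUnion (fun n => p.1.finsuppAntidiag n)) Filter.atTop Filter.atTop := by
    refine Filter.tendsto_atTop.2 fun F => ?_
    obtain ⟨S, N, h⟩ := subset_biUnion_finsuppAntidiag F
    filter_upwards [Filter.eventually_ge_atTop (S, N)] with p hp
    exact h _ _ hp.1 hp.2
  have h2 := ha.comp ht
  have h3 : Filter.Tendsto (fun p : Finset ι × ℕ => (∑ i ∈ p.1, u i) ^ p.2)
      Filter.atTop (nhds 0) := by
    have hT : 0 ≤ ∑' i, ‖u i‖ := tsum_nonneg fun i => norm_nonneg _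
    have h4 : Filter.Tendsto (fun p : Finset ι × ℕ => (∑' i, ‖u i‖) ^ p.2)
        Filter.atTop (nhds 0) :=
      (tendsto_pow_atTop_nhds_zero_of_lt_one hT h1).comp
        (by rw [← Filter.prod_atTop_atTop_eq]; exact Filter.tendsto_snd)
    refine squeeze_zero_norm (fun p => ?_) h4
    rw [norm_pow]
    gcongr
    exact (norm_sum_le _ _).trans (hs.sum_le_tsum _ fun i _ => norm_nonneg _)
  have h5 : Filter.Tendsto (fun p : Finset ι × ℕ => ∑ i ∈ p.1, u i)
      Filter.atTop (nhds (∑' i, u i)) :=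
    (hs.of_norm.hasSum).comp
      (by rw [← Filter.prod_atTop_atTop_eq]; exact Filter.tendsto_fst)
  have hne : ∀ t : ℂ, ‖t‖ < 1 → 1 - t ≠ 0 := by
    intro t ht h0
    have : t = 1 := (sub_eq_zero.1 h0).symm
    simp [this] at ht
  have hlt : ‖∑' i, u i‖ < 1 := (norm_tsum_le_tsum_norm hs).trans_lt h1
  have h6 : Filter.Tendsto (fun p : Finset ι × ℕ =>
      (1 - (∑ i ∈ p.1, u i) ^ p.2) * (1 - ∑ i ∈ p.1, u i)⁻¹) Filter.atTop
      (nhds ((1 - 0) * (1 - ∑' i, u i)⁻¹)) :=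
    (h3.const_sub 1).mul ((h5.const_sub 1).inv₀ (hne _ hlt))
  have h7 : a = (1 - 0) * (1 - ∑' i, u i)⁻¹ := by
    refine tendsto_nhds_unique h2 (h6.congr fun p => ?_)
    simp only [Function.comp]
    rw [sum_biUnion_finsuppAntidiag]
    have : ‖∑ i ∈ p.1, u i‖ < 1 :=
      ((norm_sum_le _ _).trans (hs.sum_le_tsum _ fun i _ => norm_nonneg _)).trans_lt h1
    rw [← mul_neg_geom_sum, mul_comm, ← mul_assoc, inv_mul_cancel₀ (hne _ this), one_mul]
  rw [sub_zero, one_mul] at h7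
  exact h7 ▸ ha

theorem ball_hasSum (z : DABall ι) : HasSum (fun i => ‖z.1 i‖ ^ 2) (‖z.1‖ ^ 2) := by
  simpa using! lp.hasSum_norm (p := 2) (by norm_num) z.1

theorem ball_norm_sq_lt (z : DABall ι) : ‖z.1‖ ^ 2 < 1 := by
  have : ‖z.1‖ < 1 := mem_ball_zero_iff.1 z.2
  exact pow_lt_one₀ (norm_nonneg _) this two_ne_zero

theorem memℓp_ker (z : DABall ι) :
    Memℓp (fun α : ι →₀ ℕ => (√(α.multinomial : ℝ) : ℂ) * star (daMonomial α z.1)) 2 := by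
  refine memℓp_gen ?_
  have h := ball_hasSum z
  convert summable_multinomial (fun i => ‖z.1 i‖ ^ 2) (fun i => by positivity) h.summable
    (h.tsum_eq ▸ ball_norm_sq_lt z) using 2 with α
  have := multinomial_pos' α
  simp only [ENNReal.toReal_ofNat, Real.rpow_ofNat]
  rw [norm_mul, mul_pow, Complex.norm_real, Real.norm_eq_abs, sq_abs,
    Real.sq_sqrt this.le, norm_star, daMonomial, Finsupp.prod, norm_prod, ← Finset.prod_pow]
  simp only [Finsupp.prod, norm_pow]
  congr 1
  exact Finset.prod_congr rfl fun i _ => by ring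

/-- The coordinates of the kernel function at `z`. -/
def ker (z : DABall ι) : DruryArveson ι :=
  (⟨_, memℓp_ker z⟩ : lp (fun _ : ι →₀ ℕ => ℂ) 2)

theorem hasSum_inner_ker (z : DABall ι) (f : DruryArveson ι) :
    HasSum (fun α => coeff f α * daMonomial α z.1) (inner ℂ (ker z) f) := by
  have h := lp.hasSum_inner (𝕜 := ℂ) (show lp (fun _ : ι →₀ ℕ => ℂ) 2 from ker z)
    (show lp (fun _ : ι →₀ ℕ => ℂ) 2 from f)
  refine (congrArg (HasSum · _) (funext fun α => ?_)).mp h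
  change inner ℂ ((√(Finsupp.multinomial α : ℝ) : ℂ) * star (daMonomial α z.1)) (coord f α) = _
  simp [coeff]
  ring

/-- A power series in `H²_d`, as a function on the ball. -/
def toFun (f : DruryArveson ι) (z : DABall ι) : ℂ :=
  ∑' α, coeff f α * daMonomial α z.1

theorem toFun_eq (f : DruryArveson ι) (z : DABall ι) : toFun f z = inner ℂ (ker z) f :=
  (hasSum_inner_ker z f).tsum_eq

theorem hasSum_toFun (f : DruryArveson ι) (z : DABall ι) :
    HasSum (fun α => coeff f α * daMonomial α z.1) (toFun f z) := by
  rw [toFun_eq]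
  exact hasSum_inner_ker z f

/-- The homogeneous parts of a power series in `H²_d` that vanishes on the ball vanish. -/
theorem homogeneous_eq_zero [DecidableEq ι] (f : DruryArveson ι) (hf : ∀ z, toFun f z = 0)
    (S : Finset ι) (v : ι → ℂ) (n : ℕ) :
    ∑ α ∈ S.finsuppAntidiag n, coeff f α * daMonomial α v = 0 := by
  set c : ℕ → ℂ := fun n => ∑ α ∈ S.finsuppAntidiag n, coeff f α * daMonomial α v with hc
  let y : lp (fun _ : ι => ℂ) 2 := ∑ i ∈ S, lp.single 2 i (v i)
  have hy : ∀ i, y i = if i ∈ S then v i else 0 := by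
    intro i
    simp only [y, lp.coeFn_sum, Finset.sum_apply, lp.single_apply]
    simp [Pi.single_apply]
  have hsum : ∀ t : ℂ, ‖t • y‖ < 1 → HasSum (fun n => t ^ n * c n) 0 := by
    intro t ht
    have h := hasSum_toFun f ⟨t • y, mem_ball_zero_iff.2 ht⟩
    rw [hf] at h
    have h2 := h.tsum_fiberwise (fun α : ι →₀ ℕ => α.sum fun _ k => k)
    refine (congrArg (HasSum · 0) (funext fun n => Eq.symm ?_)).mp h2
    rw [tsum_subtype ((fun α : ι →₀ ℕ => α.sum fun _ k => k) ⁻¹' {n})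
      (fun α => coeff f α * daMonomial α (t • y : lp (fun _ : ι => ℂ) 2)),
      tsum_eq_sum (s := S.finsuppAntidiag n), hc, Finset.mul_sum]
    · refine Finset.sum_congr rfl fun α hα => ?_
      rw [Finset.mem_finsuppAntidiag'] at hα
      rw [Set.indicator_of_mem (by simpa using hα.1)]
      have : daMonomial α (t • y : lp (fun _ : ι => ℂ) 2) = t ^ n * daMonomial α v := by
        rw [daMonomial, daMonomial, Finsupp.prod, Finsupp.prod, ← hα.1, Finsupp.sum,
          ← Finset.prod_pow_eq_pow_sum, ← Finset.prod_mul_distrib]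
        refine Finset.prod_congr rfl fun i hi => ?_
        rw [lp.coeFn_smul, Pi.smul_apply, hy, if_pos (hα.2 hi), smul_eq_mul, mul_pow]
      rw [this]
      ring
    · intro α hα
      by_cases hn : α ∈ (fun α : ι →₀ ℕ => α.sum fun _ k => k) ⁻¹' {n}
      · rw [Set.indicator_of_mem hn]
        rw [Finset.mem_finsuppAntidiag'] at hα
        have : ¬ α.support ⊆ S := fun h => hα ⟨by simpa using hn, h⟩
        obtain ⟨i, hi, hiS⟩ := Finset.not_subset.1 this
        rw [daMonomial, Finsupp.prod, Finset.prod_eq_zero hi, mul_zero]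
        rw [lp.coeFn_smul, Pi.smul_apply, hy, if_neg hiS, smul_zero]
        exact zero_pow (Finsupp.mem_support_iff.1 hi)
      · exact Set.indicator_of_notMem hn _
  have hp : HasFPowerSeriesAt (0 : ℂ → ℂ) (FormalMultilinearSeries.ofScalars ℂ c) 0 := by
    rw [hasFPowerSeriesAt_iff]
    have hcont : Continuous fun t : ℂ => ‖t • y‖ := by fun_prop
    have : ∀ᶠ t in nhds (0 : ℂ), ‖t • y‖ < 1 :=
      hcont.continuousAt.eventually_lt continuousAt_const (by simp)
    filter_upwards [this] with t ht
    simpa [FormalMultilinearSeries.coeff_ofScalars] using hsum t ht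
  have h0 := hp.eq_zero
  have := congrArg (fun p => FormalMultilinearSeries.coeff p n) h0
  simp only [FormalMultilinearSeries.coeff_ofScalars] at this
  exact this.trans rfl

theorem eq_zero_of_toFun (f : DruryArveson ι) (hf : ∀ z, toFun f z = 0) : f = 0 := by
  classical
  have hcoeff : ∀ α, coeff f α = 0 := by
    intro α
    let n := α.sum fun _ k => k
    let P : MvPolynomial ι ℂ :=
      ∑ β ∈ α.support.finsuppAntidiag n, MvPolynomial.monomial β (coeff f β)
    have hP : P = 0 := by
      refine MvPolynomial.funext fun v => ?_
      have := homogeneous_eq_zero f hf α.support v n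
      simpa [P, MvPolynomial.eval_monomial, daMonomial] using this
    have h2 := congrArg (MvPolynomial.coeff α) hP
    simpa [P, MvPolynomial.coeff_sum, MvPolynomial.coeff_monomial,
      Finset.mem_finsuppAntidiag, n, Finsupp.sum] using h2
  have h := hasSum_norm_sq f
  simp only [hcoeff, norm_zero, ne_eq, OfNat.ofNat_ne_zero, not_false_eq_true, zero_pow,
    zero_mul] at h
  have := h.unique hasSum_zero
  simpa using this

/-- `H²_d` as a Hilbert function space on the ball, through `f ↦ (z ↦ ∑ c_α z ^ α)`. -/
instance : RKHS ℂ (DruryArveson ι) (DABall ι) ℂ where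
  coeCLM :=
    { toFun := toFun
      map_add' := fun f g => by
        ext z
        simp [toFun_eq]
      map_smul' := fun a f => by
        ext z
        simp [toFun_eq]
      cont := by
        refine continuous_pi fun z => ?_
        simp only [toFun_eq]
        fun_prop }
  coeCLM_injective := by
    refine (injective_iff_map_eq_zero _).2 fun f h => ?_
    exact eq_zero_of_toFun f fun z => congrFun h z

theorem hasSum_apply (f : DruryArveson ι) (z : DABall ι) :
    HasSum (fun α => coeff f α * daMonomial α z.1) (f z) :=
  hasSum_toFun f z

/-- The reproducing kernel of `H²_d` is `1 / (1 - ⟨z, w⟩)`; Mathlib's inner product is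
conjugate-linear in its first argument. -/
theorem kernel_apply_one (z w : DABall ι) :
    RKHS.kernel (DruryArveson ι) z w 1 = 1 / (1 - inner ℂ w.1 z.1) := by
  have hker : RKHS.kerFun (DruryArveson ι) w 1 = ker w := by
    refine ext_inner_right ℂ fun f => ?_
    rw [RKHS.kerFun_inner, ← toFun_eq]
    simp
    rfl
  have h1 : RKHS.kernel (DruryArveson ι) z w 1 = toFun (ker w) z := by
    rw [← RKHS.kerFun_apply, hker]
    rfl
  have hin := lp.hasSum_inner (𝕜 := ℂ) w.1 z.1
  have hz := ball_hasSum z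
  have hw := ball_hasSum w
  have hbd : ∀ i, ‖inner ℂ (w.1 i) (z.1 i)‖ ≤ (‖z.1 i‖ ^ 2 + ‖w.1 i‖ ^ 2) / 2 := by
    intro i
    refine (norm_inner_le_norm _ _).trans ?_
    nlinarith [sq_nonneg (‖z.1 i‖ - ‖w.1 i‖)]
  have hmaj := (hz.add hw).div_const 2
  have hs : Summable fun i => ‖inner ℂ (w.1 i) (z.1 i)‖ :=
    Summable.of_nonneg_of_le (fun i => norm_nonneg _) hbd hmaj.summable
  have hlt : ∑' i, ‖inner ℂ (w.1 i) (z.1 i)‖ < 1 := by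
    refine (hs.tsum_le_tsum hbd hmaj.summable).trans_lt ?_
    rw [hmaj.tsum_eq]
    linarith [ball_norm_sq_lt z, ball_norm_sq_lt w]
  have h2 := hasSum_multinomial (fun i => inner ℂ (w.1 i) (z.1 i)) hs hlt
  rw [hin.tsum_eq] at h2
  rw [h1, one_div]
  refine (hasSum_toFun (ker w) z).unique ?_
  convert h2 using 2 with α
  have hm := multinomial_pos' α
  have hsq : (√(α.multinomial : ℝ) : ℂ) * (√(α.multinomial : ℝ) : ℂ) = α.multinomial := by
    rw [← Complex.ofReal_mul, Real.mul_self_sqrt hm.le]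
    simp
  change (√(α.multinomial : ℝ) : ℂ) *
    ((√(α.multinomial : ℝ) : ℂ) * star (daMonomial α w.1)) * daMonomial α z.1 = _
  rw [← mul_assoc, hsq, mul_assoc]
  congr 1
  rw [daMonomial, daMonomial, Finsupp.prod, Finsupp.prod, Finsupp.prod, star_prod,
    ← Finset.prod_mul_distrib]
  refine Finset.prod_congr rfl fun i _ => ?_
  simp [mul_pow, mul_comm]

end DruryArveson

end

/-!
Let `k` be the kernel of the Hilbert function space `H` on `X`, and suppose that
`k(z, w) (1 - ⟪b z, b w⟫) = 1` for a map `b` from `X` to an inner product space; for the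
Drury–Arveson space, `b z` is the complex conjugate of `z`.

The adjoint of multiplication by `Φ` sends `k_z ⊗ e_a` to `k_z ⊗ Φ(z)* e_a`, so `Φ` is a contractive
multiplier exactly when the Gram matrix of the vectors `k_z ⊗ e_a` dominates that of the vectors
`k_z ⊗ Φ(z)* e_a`, that is, when `(1 - Φ(z) Φ(w)*) k(z, w)` is positive semi-definite on all of `X`.

To extend `W` from the nodes to all of `X`, write its Pick matrix as the Gram matrix of vectors
`g(i, a)`. Dividing by `k` shows that `e_a ⊕ (b(x_i) ⊗ g(i, a))` and `W_i* e_a ⊕ g(i, a)` have equal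
Gram matrices, hence a contraction `T` maps the former to the latter (the lurking isometry). As
`‖b z‖ < 1`, the equation `T (e_a ⊕ (b(z) ⊗ f)) = v ⊕ f` has a unique solution `(v, f)` for each
`z`, and `Φ(z)* e_a := v` interpolates. Reading the Gram matrix computation backwards, `T` being a
contraction gives the positivity of the Pick kernel of `Φ`, by the Schur product theorem.
-/

open scoped ComplexOrder InnerProductSpace

open Matrix UniformSpace

universe u v

noncomputable section

section Gram

variable {𝕜 : Type u} {S : Type v} {K₁ K₂ : Type*} [RCLike 𝕜] [NormedAddCommGroup K₁]
  [InnerProductSpace 𝕜 K₁] [NormedAddCommGroup K₂] [InnerProductSpace 𝕜 K₂]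

theorem finsuppSum_star_mul_gram_mul (u : S → K₁) (c : S →₀ 𝕜) :
    (c.sum fun i ci => c.sum fun j cj => star ci * gram 𝕜 u i j * cj) =
      (‖Finsupp.linearCombination 𝕜 u c‖ : 𝕜) ^ 2 := by
  rw [← inner_self_eq_norm_sq_to_K (𝕜 := 𝕜), Finsupp.linearCombination_apply, Finsupp.sum_inner]
  refine Finsupp.sum_congr fun i _ => ?_
  rw [Finsupp.inner_sum]
  refine Finsupp.sum_congr fun j _ => ?_
  simp only [gram_apply, inner_smul_left, inner_smul_right, RCLike.star_def]
  ring

theorem posSemidef_gram_sub_gram_iff (u : S → K₁) (w : S → K₂) :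
    (gram 𝕜 u - gram 𝕜 w).PosSemidef ↔
      ∀ c : S →₀ 𝕜, ‖Finsupp.linearCombination 𝕜 w c‖ ≤ ‖Finsupp.linearCombination 𝕜 u c‖ := by
  have quadraticForm_eq (c : S →₀ 𝕜) : (c.sum fun i ci => c.sum fun j cj =>
      star ci * (gram 𝕜 u - gram 𝕜 w) i j * cj) =
      ((‖Finsupp.linearCombination 𝕜 u c‖ ^ 2 -
        ‖Finsupp.linearCombination 𝕜 w c‖ ^ 2 : ℝ) : 𝕜) := by
    push_cast
    simp only [← finsuppSum_star_mul_gram_mul, ← Finsupp.sum_sub, Matrix.sub_apply, mul_sub,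
      sub_mul]
  rw [PosSemidef, and_iff_right ((isHermitian_gram 𝕜 u).sub (isHermitian_gram 𝕜 w))]
  refine forall_congr' fun c => ?_
  rw [quadraticForm_eq, RCLike.ofReal_nonneg, sub_nonneg,
    sq_le_sq₀ (norm_nonneg _) (norm_nonneg _)]

variable (𝕜) in
/-- `Matrix.posSemidef_gram` covers only finite index types. -/
theorem gram_posSemidef (u : S → K₁) : (gram 𝕜 u).PosSemidef := by
  have h := (posSemidef_gram_sub_gram_iff (𝕜 := 𝕜) u (0 : S → K₁)).2 fun c => by
    simp [Finsupp.linearCombination_apply]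
  simpa using h

theorem posSemidef_gram_sub_gram_apply (u : S → K₁) {T : K₁ →L[𝕜] K₂} (hT : ‖T‖ ≤ 1) :
    (gram 𝕜 u - gram 𝕜 fun s => T (u s)).PosSemidef := by
  refine (posSemidef_gram_sub_gram_iff _ _).2 fun c => ?_
  have map_linearCombination : Finsupp.linearCombination 𝕜 (fun s => T (u s)) c =
      T (Finsupp.linearCombination 𝕜 u c) := by
    simp [Finsupp.linearCombination_apply, map_finsuppSum]
  simpa [map_linearCombination] using T.le_of_opNorm_le hT (Finsupp.linearCombination 𝕜 u c)

theorem exists_contraction_of_posSemidef_gram_sub_gram [CompleteSpace K₁] [CompleteSpace K₂]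
    {u : S → K₁} {w : S → K₂} (h : (gram 𝕜 u - gram 𝕜 w).PosSemidef) :
    ∃ T : K₁ →L[𝕜] K₂, ‖T‖ ≤ 1 ∧ ∀ s, T (u s) = w s := by
  rw [posSemidef_gram_sub_gram_iff] at h
  let U := Finsupp.linearCombination 𝕜 u
  let M : Submodule 𝕜 K₁ := U.range.topologicalClosure
  let e : (S →₀ 𝕜) →ₗ[𝕜] M :=
    Submodule.inclusion U.range.le_topologicalClosure ∘ₗ U.rangeRestrict
  have he : DenseRange e :=
    ((denseRange_inclusion_iff U.range.le_topologicalClosure).2 subset_rfl).comp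
      U.surjective_rangeRestrict.denseRange
      (continuous_inclusion U.range.le_topologicalClosure)
  have hle (c : S →₀ 𝕜) : ‖Finsupp.linearCombination 𝕜 w c‖ ≤ 1 * ‖e c‖ := by
    rw [one_mul]
    exact h c
  let T := (Finsupp.linearCombination 𝕜 w).extendOfNorm e
  refine ⟨T ∘L M.orthogonalProjectionOnto, ?_, fun s => ?_⟩
  · refine (T.opNorm_comp_le _).trans (mul_le_one₀ ?_ (norm_nonneg _) ?_)
    · exact LinearMap.opNorm_extendOfNorm_le he zero_le_one hle
    · exact M.orthogonalProjectionOnto_norm_le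
  · have hu : u s = (e (Finsupp.single s 1) : K₁) := by simp [e, U]
    rw [ContinuousLinearMap.comp_apply, hu, Submodule.orthogonalProjectionOnto_mem_subspace_eq_self]
    simpa using LinearMap.extendOfNorm_eq he ⟨1, hle⟩ (Finsupp.single s 1)

theorem posSemidef_gram_sub_gram_iff_exists_inner_eq [CompleteSpace K₁] [CompleteSpace K₂]
    (u : S → K₁) (w : S → K₂) :
    (gram 𝕜 u - gram 𝕜 w).PosSemidef ↔
      ∀ y : K₂, ∃ x : K₁, ‖x‖ ≤ ‖y‖ ∧ ∀ s, ⟪u s, x⟫_𝕜 = ⟪w s, y⟫_𝕜 := by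
  refine ⟨fun h y => ?_, fun h => (posSemidef_gram_sub_gram_iff u w).2 fun c => ?_⟩
  · obtain ⟨T, hT, hTu⟩ := exists_contraction_of_posSemidef_gram_sub_gram h
    have hT' : ‖T.adjoint‖ ≤ 1 := by rwa [LinearIsometryEquiv.norm_map]
    refine ⟨T.adjoint y, by simpa using T.adjoint.le_of_opNorm_le hT' y, fun s => ?_⟩
    rw [T.adjoint_inner_right, hTu]
  · set uc := Finsupp.linearCombination 𝕜 u c with huc
    set wc := Finsupp.linearCombination 𝕜 w c with hwc
    obtain ⟨x, hx, hxw⟩ := h wc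
    have inner_eq : ⟪uc, x⟫_𝕜 = ⟪wc, wc⟫_𝕜 := by
      conv_rhs => rw [hwc, Finsupp.linearCombination_apply, Finsupp.sum_inner]
      simp only [huc, Finsupp.linearCombination_apply, Finsupp.sum_inner, inner_smul_left, hxw]
      rfl
    have norm_mul_norm_le : ‖wc‖ * ‖wc‖ ≤ ‖uc‖ * ‖wc‖ :=
      calc ‖wc‖ * ‖wc‖ = ‖⟪uc, x⟫_𝕜‖ := by
            rw [inner_eq, inner_self_eq_norm_sq_to_K, norm_pow, RCLike.norm_ofReal, abs_norm, sq]
        _ ≤ ‖uc‖ * ‖x‖ := norm_inner_le_norm _ _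
        _ ≤ ‖uc‖ * ‖wc‖ := by gcongr
    rcases (norm_nonneg wc).eq_or_lt with hzero | hpos
    · exact hzero.symm.trans_le (norm_nonneg uc)
    · exact le_of_mul_le_mul_right norm_mul_norm_le hpos

theorem exists_gram_eq_of_posSemidef {M : Matrix S S 𝕜} (hM : M.PosSemidef) :
    ∃ (F : Type (max u v)) (_ : NormedAddCommGroup F) (_ : InnerProductSpace 𝕜 F)
      (_ : CompleteSpace F) (g : S → F), gram 𝕜 g = M := by
  let K : Matrix S S (𝕜 →L[𝕜] 𝕜) := M.map fun c => c • 1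
  have hK : K.PosSemidef := by
    refine (RKHS.posSemidef_tfae.out 0 2 : K.PosSemidef ↔ K.IsHermitian ∧ ∀ c : S →₀ 𝕜,
      0 ≤ RCLike.re (c.sum fun i ci => c.sum fun j cj => ⟪K j i ci, cj⟫_𝕜)).2 ⟨?_, fun c => ?_⟩
    · exact hM.1.map _ fun c => by simp
    · refine (RCLike.nonneg_iff.1 (hM.2 c)).1.trans_eq (congrArg _ ?_)
      refine Finsupp.sum_congr fun i _ => Finsupp.sum_congr fun j _ => ?_
      rw [← hM.1.apply i j]
      simp only [K, map_apply, RCLike.star_def, _root_.smul_apply, one_apply_eq_self, smul_eq_mul,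
        RCLike.inner_apply, map_mul]
      ring
  have : Fact K.PosSemidef := ⟨hK⟩
  refine ⟨RKHS.OfKernel K, inferInstance, inferInstance, inferInstance,
    fun s => RKHS.kerFun (RKHS.OfKernel K) s 1, ?_⟩
  ext i j
  rw [gram_apply, RKHS.kerFun_inner, RKHS.kerFun_apply, RKHS.OfKernel.kernel_ofKernel]
  simp [K]

end Gram

section PickKernel

variable {𝕜 S X κ : Type*} [RCLike 𝕜] [Fintype κ]

/-- The vector `W* e_a`, whose entries are the conjugates of those of the row `a` of `W`. -/
def conjRow {ρ : Type*} (W : Matrix ρ κ 𝕜) (a : ρ) : EuclideanSpace 𝕜 κ :=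
  WithLp.toLp 2 (star (W a))

theorem inner_conjRow {ρ ρ' : Type*} (V : Matrix ρ κ 𝕜) (W : Matrix ρ' κ 𝕜) (a : ρ) (b : ρ') :
    ⟪conjRow V a, conjRow W b⟫_𝕜 = (V * Wᴴ) a b := by
  simp [conjRow, PiLp.inner_apply, Matrix.mul_apply, mul_comm]

variable (H : Type*) [NormedAddCommGroup H] [InnerProductSpace 𝕜 H] [RKHS 𝕜 H X 𝕜]
  [CompleteSpace H]

theorem inner_kerFun_one_kerFun_one (z w : X) :
    ⟪RKHS.kerFun H z (1 : 𝕜), RKHS.kerFun H w 1⟫_𝕜 = RKHS.kernel H z w 1 := by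
  rw [RKHS.kerFun_inner, RKHS.kerFun_apply, RCLike.inner_apply, map_one (starRingEnd 𝕜), mul_one]

/-- The elementary tensor `k_z ⊗ v` in `H ⊗ 𝕜^κ`, which is encoded as a direct sum of copies
of `H`. -/
def kernelTensor (z : X) (v : EuclideanSpace 𝕜 κ) : PiLp 2 fun _ : κ => H :=
  WithLp.toLp 2 fun a => v a • RKHS.kerFun H z 1

theorem inner_kernelTensor_conjRow {ρ : Type*} (z : X) (W : Matrix ρ κ 𝕜) (a : ρ)
    (h : PiLp 2 fun _ : κ => H) :
    ⟪kernelTensor H z (conjRow W a), h⟫_𝕜 = ∑ b, W a b * h b z := by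
  simp [kernelTensor, conjRow, PiLp.inner_apply, inner_smul_left]

theorem inner_kernelTensor_kernelTensor (z w : X) (v v' : EuclideanSpace 𝕜 κ) :
    ⟪kernelTensor H z v, kernelTensor H w v'⟫_𝕜 = ⟪v, v'⟫_𝕜 * RKHS.kernel H z w 1 := by
  simp only [PiLp.inner_apply, Finset.sum_mul]
  refine Finset.sum_congr rfl fun a _ => ?_
  rw [kernelTensor, kernelTensor, inner_smul_left, inner_smul_right, inner_kerFun_one_kerFun_one,
    RCLike.inner_apply]
  ring

variable [DecidableEq κ]

/-- The Pick matrix of matrices `W s` prescribed at arbitrarily many points `x s`. For finitely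
many points it is `pickMatrix`; for `x = id` it is the kernel `(1 - W(z) W(w)*) k(z, w)` on all
of `X`. -/
def pickKernel (x : S → X) (W : S → Matrix κ κ 𝕜) : Matrix (S × κ) (S × κ) 𝕜 :=
  of fun p q => (1 - W p.1 * (W q.1)ᴴ) p.2 q.2 * RKHS.kernel H (x p.1) (x q.1) 1

theorem pickKernel_eq_gram_sub_gram (x : S → X) (W : S → Matrix κ κ 𝕜) :
    pickKernel H x W =
      gram 𝕜 (fun p : S × κ => kernelTensor H (x p.1) (conjRow (1 : Matrix κ κ 𝕜) p.2)) -
        gram 𝕜 (fun p : S × κ => kernelTensor H (x p.1) (conjRow (W p.1) p.2)) := by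
  ext p q
  simp only [pickKernel, of_apply, Matrix.sub_apply, gram_apply, inner_kernelTensor_kernelTensor,
    inner_conjRow, conjTranspose_one, mul_one, sub_mul]

end PickKernel

section Multiplier

variable {X : Type*} (H : Type*) [NormedAddCommGroup H] [InnerProductSpace ℂ H] [RKHS ℂ H X ℂ]

theorem isContractiveMultiplier_iff_exists {m : ℕ} (Φ : X → Matrix (Fin m) (Fin m) ℂ) :
    IsContractiveMultiplier H Φ ↔
      ∀ h : PiLp 2 fun _ : Fin m => H, ∃ g : PiLp 2 fun _ : Fin m => H,
        ‖g‖ ≤ ‖h‖ ∧ ∀ x a, g a x = ∑ b, Φ x a b * h b x := by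
  refine ⟨fun ⟨hΦ, hle⟩ h => ?_, fun hΦ => ⟨fun a b f => ?_, fun h g hg => ?_⟩⟩
  · choose G hG using fun a b => hΦ a b (h b)
    let g : PiLp 2 fun _ : Fin m => H := WithLp.toLp 2 fun a => ∑ b, G a b
    have hg (x : X) (a : Fin m) : g a x = ∑ b, Φ x a b * h b x := by
      have coe_sum : ⇑(∑ b, G a b) = ∑ b, ⇑(G a b) := map_sum (RKHS.coeCLM ℂ) (G a) Finset.univ
      exact (congrFun coe_sum x).trans (by simp only [Finset.sum_apply, hG])
    exact ⟨g, hle h g hg, hg⟩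
  · obtain ⟨g, -, hg⟩ := hΦ (WithLp.toLp 2 (Pi.single b f))
    refine ⟨g a, fun x => ?_⟩
    rw [hg, Finset.sum_eq_single b] <;> simp +contextual
  · obtain ⟨g', hle, hg'⟩ := hΦ h
    have : g = g' := PiLp.ext fun a => RKHS.ext fun x => (hg x a).trans (hg' x a).symm
    rwa [this]

theorem isContractiveMultiplier_iff_posSemidef [CompleteSpace H] {m : ℕ}
    (Φ : X → Matrix (Fin m) (Fin m) ℂ) :
    IsContractiveMultiplier H Φ ↔ (pickKernel H id Φ).PosSemidef := by
  rw [isContractiveMultiplier_iff_exists, pickKernel_eq_gram_sub_gram,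
    posSemidef_gram_sub_gram_iff_exists_inner_eq]
  simp only [inner_kernelTensor_conjRow, Prod.forall, id_eq, Matrix.one_apply, ite_mul, one_mul,
    zero_mul, Finset.sum_ite_eq, Finset.mem_univ, if_true]

end Multiplier

section Realization

theorem existsUnique_apply_toLp_snd_eq {𝕜 E E' F G : Type*} [NontriviallyNormedField 𝕜]
    [NormedAddCommGroup E] [NormedSpace 𝕜 E] [NormedAddCommGroup E'] [NormedSpace 𝕜 E']
    [CompleteSpace E'] [NormedAddCommGroup F] [NormedSpace 𝕜 F] [CompleteSpace F]
    [NormedAddCommGroup G] [NormedSpace 𝕜 G] {p : ENNReal} [Fact (1 ≤ p)]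
    {T : WithLp p (E × G) →L[𝕜] WithLp p (E' × F)} (hT : ‖T‖ ≤ 1) {V : F →L[𝕜] G} (hV : ‖V‖ < 1)
    (e : E) : ∃! y, T (WithLp.toLp p (e, V y.snd)) = y := by
  have hcontr : ContractingWith ‖V‖₊ fun y => T (WithLp.toLp p (e, V y.snd)) := by
    refine ⟨hV, LipschitzWith.of_dist_le_mul fun y y' => ?_⟩
    rw [dist_eq_norm, dist_eq_norm, ← map_sub, ← WithLp.toLp_sub, Prod.mk_sub_mk, sub_self,
      ← map_sub, ← WithLp.sub_snd]
    calc ‖T (WithLp.toLp p (0, V (y - y').snd))‖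
        ≤ 1 * ‖WithLp.toLp p ((0 : E), V (y - y').snd)‖ := T.le_of_opNorm_le hT _
      _ = ‖V (y - y').snd‖ := by rw [one_mul, WithLp.norm_toLp_snd]
      _ ≤ ‖V‖ * ‖(y - y').snd‖ := V.le_opNorm _
      _ ≤ ‖V‖ * ‖y - y'‖ := by gcongr; exact WithLp.norm_snd_le _ _
  exact ⟨hcontr.fixedPoint _, hcontr.fixedPoint_isFixedPt, fun y hy => hcontr.fixedPoint_unique hy⟩

variable {𝕜 L F : Type*} [RCLike 𝕜] [NormedAddCommGroup L] [InnerProductSpace 𝕜 L]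
  [NormedAddCommGroup F] [InnerProductSpace 𝕜 F]

variable (𝕜 F) in
/-- The map `f ↦ v ⊗ f` into the Hilbert space tensor product, which is the completion of the
algebraic one. -/
def hilbertTmul (v : L) : F →L[𝕜] Completion (TensorProduct 𝕜 L F) :=
  Completion.toComplL ∘L TensorProduct.mkL 𝕜 L F v

theorem inner_hilbertTmul (v w : L) (f g : F) :
    ⟪hilbertTmul 𝕜 F v f, hilbertTmul 𝕜 F w g⟫_𝕜 = ⟪v, w⟫_𝕜 * ⟪f, g⟫_𝕜 := by
  simp [hilbertTmul]

theorem norm_hilbertTmul_le (v : L) : ‖hilbertTmul 𝕜 F v‖ ≤ ‖v‖ :=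
  ContinuousLinearMap.opNorm_le_bound _ (norm_nonneg v) fun f => by simp [hilbertTmul]

variable {X S κ : Type*} [Fintype κ] [DecidableEq κ]

variable (𝕜) in
/-- The vectors `e_a ⊕ (b(x_s) ⊗ g(s, a))`, which the contraction of the realization sends to the
`colligationOutput`. -/
def colligationInput (b : X → L) (x : S → X) (g : S × κ → F) (p : S × κ) :
    WithLp 2 (EuclideanSpace 𝕜 κ × Completion (TensorProduct 𝕜 L F)) :=
  WithLp.toLp 2 (conjRow 1 p.2, hilbertTmul 𝕜 F (b (x p.1)) (g p))

/-- The vectors `W_s* e_a ⊕ g(s, a)`, the values of the contraction of the realization at the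
`colligationInput`. -/
def colligationOutput (W : S → Matrix κ κ 𝕜) (g : S × κ → F) (p : S × κ) :
    WithLp 2 (EuclideanSpace 𝕜 κ × F) :=
  WithLp.toLp 2 (conjRow (W p.1) p.2, g p)

theorem gram_colligationInput_sub_gram_colligationOutput_apply (b : X → L) (x : S → X)
    (W : S → Matrix κ κ 𝕜) (g : S × κ → F) (p q : S × κ) :
    (gram 𝕜 (colligationInput 𝕜 b x g) - gram 𝕜 (colligationOutput W g)) p q =
      (1 - W p.1 * (W q.1)ᴴ) p.2 q.2 - (1 - ⟪b (x p.1), b (x q.1)⟫_𝕜) * ⟪g p, g q⟫_𝕜 := by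
  simp only [Matrix.sub_apply, gram_apply, colligationInput, colligationOutput,
    WithLp.prod_inner_apply, inner_conjRow, inner_hilbertTmul, conjTranspose_one, mul_one]
  ring

variable {H : Type*} [NormedAddCommGroup H] [InnerProductSpace 𝕜 H] [RKHS 𝕜 H X 𝕜] [CompleteSpace H]
  {b : X → L} (hb : ∀ z w, RKHS.kernel H z w 1 * (1 - ⟪b z, b w⟫_𝕜) = 1)

include hb

theorem norm_lt_one_of_kernel_mul_one_sub_inner_eq_one (z : X) : ‖b z‖ < 1 := by
  have kernel_self : RKHS.kernel H z z 1 = ((‖RKHS.kerFun H z (1 : 𝕜)‖ ^ 2 : ℝ) : 𝕜) := by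
    have h := inner_self_eq_norm_sq_to_K (𝕜 := 𝕜) (RKHS.kerFun H z 1)
    rw [inner_kerFun_one_kerFun_one] at h
    exact_mod_cast h
  have h := hb z z
  rw [kernel_self, inner_self_eq_norm_sq_to_K (𝕜 := 𝕜)] at h
  have norm_sq_mul : ‖RKHS.kerFun H z (1 : 𝕜)‖ ^ 2 * (1 - ‖b z‖ ^ 2) = 1 := by exact_mod_cast h
  have : 0 < 1 - ‖b z‖ ^ 2 := pos_of_mul_pos_right (norm_sq_mul.symm ▸ one_pos) (sq_nonneg _)
  exact (sq_lt_one_iff₀ (norm_nonneg _)).1 (sub_pos.1 this)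

theorem gram_colligation_hadamard_gram_kerFun (x : S → X) (W : S → Matrix κ κ 𝕜) (g : S × κ → F) :
    (gram 𝕜 (colligationInput 𝕜 b x g) - gram 𝕜 (colligationOutput W g)) ⊙
        gram 𝕜 (fun p : S × κ => RKHS.kerFun H (x p.1) 1) =
      pickKernel H x W - gram 𝕜 g := by
  ext p q
  rw [hadamard_apply, gram_colligationInput_sub_gram_colligationOutput_apply, gram_apply,
    inner_kerFun_one_kerFun_one]
  simp only [Matrix.sub_apply, pickKernel, of_apply, gram_apply]
  linear_combination -⟪g p, g q⟫_𝕜 * hb (x p.1) (x q.1)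

theorem gram_colligationInput_eq_gram_colligationOutput {x : S → X} {W : S → Matrix κ κ 𝕜}
    {g : S × κ → F} (hg : gram 𝕜 g = pickKernel H x W) :
    gram 𝕜 (colligationInput 𝕜 b x g) = gram 𝕜 (colligationOutput W g) := by
  have h := gram_colligation_hadamard_gram_kerFun hb x W g
  rw [hg, sub_self] at h
  rw [← sub_eq_zero]
  ext p q
  refine (mul_eq_zero.1 (congrFun₂ h p q)).resolve_right ?_
  rw [gram_apply, inner_kerFun_one_kerFun_one]
  exact left_ne_zero_of_mul_eq_one (hb (x p.1) (x q.1))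

theorem posSemidef_pickKernel_of_apply_colligationInput {x : S → X} {W : S → Matrix κ κ 𝕜}
    {g : S × κ → F} {T : WithLp 2 (EuclideanSpace 𝕜 κ × Completion (TensorProduct 𝕜 L F)) →L[𝕜]
      WithLp 2 (EuclideanSpace 𝕜 κ × F)} (hT : ‖T‖ ≤ 1)
    (h : ∀ p, T (colligationInput 𝕜 b x g p) = colligationOutput W g p) :
    (pickKernel H x W).PosSemidef := by
  have hdom := posSemidef_gram_sub_gram_apply (colligationInput 𝕜 b x g) hT
  simp only [h] at hdom
  rw [← sub_add_cancel (pickKernel H x W) (gram 𝕜 g), ← gram_colligation_hadamard_gram_kerFun hb]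
  exact (hdom.hadamard (gram_posSemidef 𝕜 _)).add (gram_posSemidef 𝕜 g)

theorem exists_posSemidef_pickKernel_extension {x : S → X} {W : S → Matrix κ κ 𝕜}
    (hW : (pickKernel H x W).PosSemidef) :
    ∃ Φ : X → Matrix κ κ 𝕜, (pickKernel H id Φ).PosSemidef ∧ ∀ s, Φ (x s) = W s := by
  obtain ⟨F, _, _, _, g, hg⟩ := exists_gram_eq_of_posSemidef hW
  obtain ⟨T, hT, hTg⟩ := exists_contraction_of_posSemidef_gram_sub_gram (𝕜 := 𝕜)
    (u := colligationInput 𝕜 b x g) (w := colligationOutput W g)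
    (by rw [gram_colligationInput_eq_gram_colligationOutput hb hg, sub_self]; exact .zero)
  choose y hy y_unique using fun p : X × κ => existsUnique_apply_toLp_snd_eq hT
    ((norm_hilbertTmul_le (F := F) (b p.1)).trans_lt
      (norm_lt_one_of_kernel_mul_one_sub_inner_eq_one hb p.1)) (conjRow 1 p.2)
  let Φ : X → Matrix κ κ 𝕜 := fun z => of fun a => star (y (z, a)).fst.ofLp
  refine ⟨Φ, posSemidef_pickKernel_of_apply_colligationInput hb (g := fun p => (y p).snd) hT
    fun p => (hy p).trans ?_, fun s => ?_⟩
  · refine WithLp.ofLp_injective 2 (Prod.ext (WithLp.ofLp_injective 2 ?_) rfl)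
    exact (star_star _).symm
  · ext a c
    have hout : colligationOutput W g (s, a) = y (x s, a) := y_unique (x s, a) _ (hTg (s, a))
    simp [Φ, ← hout, colligationOutput, conjRow]

end Realization

theorem mainTheorem5_general {X H L : Type*} [NormedAddCommGroup L] [InnerProductSpace ℂ L]
    [NormedAddCommGroup H] [InnerProductSpace ℂ H] [RKHS ℂ H X ℂ] [CompleteSpace H] {b : X → L}
    (hb : ∀ z w, RKHS.kernel H z w 1 * (1 - ⟪b z, b w⟫_ℂ) = 1) : HasCompletePickProperty H := by
  intro m n x W
  simp only [isContractiveMultiplier_iff_posSemidef]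
  constructor
  · rintro ⟨Φ, hΦ, hW⟩
    obtain rfl : (fun i => Φ (x i)) = W := funext hW
    exact hΦ.submatrix (Prod.map x id)
  · exact exists_posSemidef_pickKernel_extension hb

theorem DruryArveson.kernel_mul_one_sub_inner_star {ι : Type*} (z w : DABall ι) :
    RKHS.kernel (DruryArveson ι) z w 1 * (1 - ⟪star z.1, star w.1⟫_ℂ) = 1 := by
  have inner_star : ⟪star z.1, star w.1⟫_ℂ = ⟪w.1, z.1⟫_ℂ := by
    simp [lp.inner_eq_tsum, mul_comm]
  have norm_inner_lt : ‖⟪w.1, z.1⟫_ℂ‖ < 1 :=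
    (norm_inner_le_norm _ _).trans_lt (mul_lt_one_of_nonneg_of_lt_one_left (norm_nonneg _)
      (mem_ball_zero_iff.1 w.2) (mem_ball_zero_iff.1 z.2).le)
  rw [inner_star, kernel_apply_one, one_div_mul_cancel]
  intro h
  simp [← sub_eq_zero.1 h] at norm_inner_lt

end

theorem mainTheorem5 (ι : Type*) [Countable ι] :
    HasCompletePickProperty (DruryArveson ι) :=
  mainTheorem5_general DruryArveson.kernel_mul_one_sub_inner_star
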